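/- **Setting.** Let $f_0:\mathbb R^{n_0}\to\mathbb R$, $c_0:\mathbb R^{n_0}\to\mathbb R^{m_0}$ and, for $i=1,\dots,N$, $f_i:\mathbb R^{n_i}\times\mathbb R^{n_0}\to\mathbb R$, $c_i:\mathbb R^{n_i}\times\mathbb R^{n_0}\to\mathbb R^{m_i}$; let $\mu>0$ be fixed. For $v_i=(y_i,\tilde x_i,s_i,\lambda_i,\eta_i)$ put $\mathcal L_i=f_i(y_i;\tilde x_i)+(c_i(y_i;\tilde x_i)+s_i)^T\lambda_i+(\tilde x_i-x)^T\eta_i$ and $$F_i(v_i;x)=\bigl(\nabla_{y_i}\mathcal L_i,\ \nabla_{\tilde x_i}\mathcal L_i,\ s_i\circ\lambda_i-\mu e,\ c_i(y_i;\tilde x_i)+s_i,\ \tilde x_i-x\bigr),\qquad \mathcal S_i=\{(x,v_i):F_i(v_i;x)=0\}.$$ A KKT point for $x$ is a $v_i$ with $(x,v_i)\in\mathcal S_i$ and $s_i>0$. A point $(x,v_i)\in\mathcal S_i$ is nondegenerate if $\nabla_{v_i}F_i(v_i;x)$ is nonsingular. A solution map on $U\subseteq\mathbb R^{n_0}$ with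 reference point $(\bar x,\bar v_i)$ is a continuous $v_i^*:U\to\mathbb R^{n_{v_i}}$ with $(x,v_i^*(x))\in\mathcal S_i$ for $x\in U$ and $v_i^*(\bar x)=\bar v_i$. The second-stage value based on $(x,v_i)$ is $f_i(y_i;x)-\mu\sum_j\ln s_{ij}$ (objective smoothing) or $f_i(y_i;x)$ (solution smoothing); one of the two is chosen throughout. Write $\hat f_i(\cdot;(\bar x,\bar v_i))$ for this value along a solution map $v_i^*$ defined near $\bar x$ with reference point $(\bar x,\bar v_i)$, and, with a penalty parameter $\pi>0$, $$\phi(x;(\bar x,\bar v))=f_0(x)+\sum_{i=1}^N\hat f_i(x;(\bar x,\bar v_i))+\pi\|[c_0(x)]^+\|_1 .$$ Let $\partial\phi(x)$ be the set of $g$ with $g^Td\le\lim_{t\downarrow0}(\phi(x+td)-\phi(x))/t$ for all $d$ (the limits being required to exist); $x$ is stationary for $\phi$ if the minimum-norm element of $\partial\phi(x)$ is $0$. **Algorithm.** Parameters: $0<\Delta^0\le\bar\Delta$, $\pi>0$, $0<\eta_1\le\eta_2<1$, $0<1/\gamma_3\le\gamma_1\le\gamma_2<1<\gamma_3$. Given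 $x^0$ and starting points, the subproblem solver is called at $x^0$ and returns $v^0=(v_i^0)_i$. At iteration $k$, $\phi(x^k)$ denotes the penalty function with second-stage values based on $(x^k,v_i^k)$, and $g_i^k$ is the returned second-stage gradient, which equals the gradient at $x^k$ of $\hat f_i(\cdot;(x^k,v_i^k))$ whenever $(x^k,v_i^k)$ is nondegenerate (and is arbitrary otherwise). With $H^k$ symmetric, $$m^k(p)=f_0(x^k)+\sum_i\hat f_i(x^k)+\Bigl(\nabla f_0(x^k)+\sum_i g_i^k\Bigr)^Tp+\tfrac12p^TH^kp+\pi\|[c_0(x^k)+\nabla c_0(x^k)^Tp]^+\|_1,$$ and $p^k$ is a global minimizer of $m^k$ over $\|p\|\le\Delta^k$; the algorithm stops if $p^k=0$. Otherwise the solver, started from $v_i^k$, is called at $x^k+p^k$ and returns $\tilde v_i^k$; with $\phi(x^k+p^k)$ based on $(x^k+p^k,\tilde v_i^k)$, let $\rho^k=\frac{\phi(x^k)-\phi(x^k+p^k)}{m^k(0)-m^k(p^k)}$ ($\rho^k:=0$ if the denominator vanishes). If $\rho^k\ge\eta_1$, set $(x^{k+1},v^{k+1})=(x^k+p^k,\tilde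 v^k)$, otherwise $(x^{k+1},v^{k+1})=(x^k,v^k)$. The radius satisfies $\Delta^{k+1}\in[\min\{\gamma_3\Delta^k,\bar\Delta\},\bar\Delta]$ if $\rho^k\ge\eta_2$, $\Delta^{k+1}\in[\gamma_2\Delta^k,\Delta^k]$ if $\eta_1\le\rho^k<\eta_2$, and $\Delta^{k+1}\in[\gamma_1\Delta^k,\gamma_2\Delta^k]$ if $\rho^k<\eta_1$. **Assumptions.** (1) *Smoothness:* $f_0,c_0$ are $C^1$ with locally Lipschitz first derivatives; for objective smoothing $f_i,c_i$ are $C^2$ with locally Lipschitz second derivatives, for solution smoothing they are $C^3$. (2) *Full recourse:* for each $x$ sent to the subproblems during the run, every subproblem ($c_i(\cdot;x)\le0$) is feasible and the solver returns a KKT point. (3) *Consistent output:* for every $i$ and every nondegenerate $(\bar x,\bar v_i)\in\mathcal S_i$ there are $r_2>0$, such that every point of $\mathcal S_i\cap B((\bar x,\bar v_i),r_2)$ lies on the graph of one $C^1$ solution map with reference point $(\bar x,\bar v_i)$ defined on a ball around $\bar x$ of radius at least $r_2$ (such radii exist by the implicit function theorem), and $r_3>0$ with the following property: whenever an iterate satisfies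 $(x^k,v_i^k)\in B((\bar x,\bar v_i),r_3)$ and $\|p\|\le r_3$, the output $v_i^+$ of the solver at $x^+=x^k+p$, started from $v_i^k$, satisfies $(x^+,v_i^+)\in B((\bar x,\bar v_i),r_2)$. (4) $\{H^k\}$ is bounded. **Theorem.** Under (1)–(4), let $(x^\infty,v^\infty)$, $v^\infty=(v_i^\infty)_i$, be a limit point of the sequence $\{(x^k,v^k)\}$ generated by a non-terminating run of the algorithm, and suppose that $\nabla_{v_i}F_i(v_i^\infty;x^\infty)$ is nonsingular for every $i$. Then on some ball around $x^\infty$ there are, for every $i$, $C^1$ solution maps with reference points $(x^\infty,v_i^\infty)$ consisting of KKT points, and $x^\infty$ is a stationary point of the local penalty function $\phi(\cdot;(x^\infty,v^\infty))$, for any choice of solution maps near $x^\infty$ with these reference points. -/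

import Mathlib

open Filter Topology Set

noncomputable section

/-- `ℝⁿ` with the Euclidean norm. -/
abbrev Vec (n : ℕ) := EuclideanSpace ℝ (Fin n)

/-- Data of a two-stage problem with `N` subproblems. `f i (y, x)` and `c i (y, x)` stand for
`fᵢ(y; x)` and `cᵢ(y; x)`. -/
structure TwoStageProblem where
  (n₀ m₀ N : ℕ)
  (n m : Fin N → ℕ)
  f₀ : Vec n₀ → ℝ
  c₀ : Vec n₀ → Vec m₀
  f : (i : Fin N) → Vec (n i) × Vec n₀ → ℝ
  c : (i : Fin N) → Vec (n i) × Vec n₀ → Vec (m i)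

/-- The two ways of smoothing the second-stage functions. -/
inductive Smoothing
  | objective
  | solution

namespace TwoStageProblem

variable (P : TwoStageProblem)

/-- The space of first-stage variables `x`. -/
abbrev X := Vec P.n₀

/-- The space of primal-dual variables `vᵢ = (yᵢ, x̃ᵢ, sᵢ, λᵢ, ηᵢ)` of the `i`-th subproblem. -/
abbrev V (i : Fin P.N) := Vec (P.n i) × Vec P.n₀ × Vec (P.m i) × Vec (P.m i) × Vec P.n₀

variable {P}

abbrev yPart {i : Fin P.N} (v : P.V i) : Vec (P.n i) := v.1
abbrev xPart {i : Fin P.N} (v : P.V i) : Vec P.n₀ := v.2.1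
abbrev sPart {i : Fin P.N} (v : P.V i) : Vec (P.m i) := v.2.2.1
abbrev lamPart {i : Fin P.N} (v : P.V i) : Vec (P.m i) := v.2.2.2.1
abbrev etaPart {i : Fin P.N} (v : P.V i) : Vec P.n₀ := v.2.2.2.2

variable (P)

/-- Smoothness of the problem functions, depending on the smoothing that is used. -/
structure IsSmooth (sm : Smoothing) : Prop where
  f₀_C1 : ContDiff ℝ 1 P.f₀
  f₀_lip : LocallyLipschitz (fderiv ℝ P.f₀)
  c₀_C1 : ContDiff ℝ 1 P.c₀
  c₀_lip : LocallyLipschitz (fderiv ℝ P.c₀)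
  objective : sm = Smoothing.objective → ∀ i,
    ContDiff ℝ 2 (P.f i) ∧ LocallyLipschitz (fderiv ℝ (fderiv ℝ (P.f i))) ∧
    ContDiff ℝ 2 (P.c i) ∧ LocallyLipschitz (fderiv ℝ (fderiv ℝ (P.c i)))
  solution : sm = Smoothing.solution → ∀ i, ContDiff ℝ 3 (P.f i) ∧ ContDiff ℝ 3 (P.c i)

/-- The Lagrangian `fᵢ(y; x̃) + (cᵢ(y; x̃) + s)ᵀ λ + (x̃ - x)ᵀ η`. -/
def lagrangian (i : Fin P.N) (y : Vec (P.n i)) (xt : P.X) (s lam : Vec (P.m i)) (eta : P.X)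
    (x : P.X) : ℝ :=
  P.f i (y, xt) + inner ℝ (P.c i (y, xt) + s) lam + inner ℝ (xt - x) eta

/-- The primal-dual optimality map `Fᵢ(vᵢ; x, μ)` of the barrier subproblem. -/
def kktMap (μ : ℝ) (i : Fin P.N) (x : P.X) (v : P.V i) : P.V i :=
  (gradient (fun y => P.lagrangian i y (xPart v) (sPart v) (lamPart v) (etaPart v) x) (yPart v),
   gradient (fun xt => P.lagrangian i (yPart v) xt (sPart v) (lamPart v) (etaPart v) x) (xPart v),
   WithLp.toLp 2 (fun j => sPart v j * lamPart v j - μ),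
   P.c i (yPart v, xPart v) + sPart v,
   xPart v - x)

/-- The set `𝒮ᵢ` of pairs `(x, vᵢ)` with `Fᵢ(vᵢ; x, μ) = 0`. -/
def stationarySet (μ : ℝ) (i : Fin P.N) : Set (P.X × P.V i) :=
  {q | P.kktMap μ i q.1 q.2 = 0}

/-- `v` is a KKT point of the barrier subproblem with parameter `x`: the slacks are in the domain
of the logarithm and the optimality conditions hold (so the multipliers are positive as well). -/
def IsKKTPoint (μ : ℝ) (i : Fin P.N) (x : P.X) (v : P.V i) : Prop :=
  (x, v) ∈ P.stationarySet μ i ∧ ∀ j, 0 < sPart v j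

/-- `∇_{vᵢ} Fᵢ(vᵢ; x)` is nonsingular. -/
def JacobianNonsingular (μ : ℝ) (i : Fin P.N) (x : P.X) (v : P.V i) : Prop :=
  Function.Bijective (fderiv ℝ (fun w => P.kktMap μ i x w) v)

/-- A nondegenerate stationary point. -/
def IsNondegenerate (μ : ℝ) (i : Fin P.N) (x : P.X) (v : P.V i) : Prop :=
  (x, v) ∈ P.stationarySet μ i ∧ P.JacobianNonsingular μ i x v

/-- `(x, v)` lies in the open Euclidean ball of radius `r` around `(xb, vb)`. -/
def InBall {i : Fin P.N} (xb : P.X) (vb : P.V i) (r : ℝ) (x : P.X) (v : P.V i) : Prop :=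
  Real.sqrt (‖x - xb‖ ^ 2 + ‖yPart v - yPart vb‖ ^ 2 + ‖xPart v - xPart vb‖ ^ 2 +
    ‖sPart v - sPart vb‖ ^ 2 + ‖lamPart v - lamPart vb‖ ^ 2 + ‖etaPart v - etaPart vb‖ ^ 2) < r

/-- `W` is a solution map on `U` (with respect to KKT points of the barrier subproblem) with the
reference point `(xb, vb)`. -/
structure IsSolutionMap (μ : ℝ) (i : Fin P.N) (xb : P.X) (vb : P.V i) (U : Set P.X)
    (W : P.X → P.V i) : Prop where
  continuousOn : ContinuousOn W U
  mem : ∀ x ∈ U, (x, W x) ∈ P.stationarySet μ i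
  ref : W xb = vb

/-- In the ball of radius `r₂` around `(xb, vb)` the zero set of `Fᵢ` is contained in the graph of a
`C¹` solution map with reference point `(xb, vb)`, which is defined on a ball of radius
`r₁ ≥ r₂` around `xb`. -/
def IsGraphRadius (μ : ℝ) (i : Fin P.N) (xb : P.X) (vb : P.V i) (r₂ : ℝ) : Prop :=
  0 < r₂ ∧ ∃ r₁, r₂ ≤ r₁ ∧ ∃ W : P.X → P.V i,
    ContDiffOn ℝ 1 W (Metric.ball xb r₁) ∧
    P.IsSolutionMap μ i xb vb (Metric.ball xb r₁) W ∧
    ∀ x v, P.InBall xb vb r₂ x v → (x, v) ∈ P.stationarySet μ i → v = W x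

/-- The smoothed second-stage objective value at `x` that is based on the primal-dual point `v`. -/
def stageValue (sm : Smoothing) (μ : ℝ) (i : Fin P.N) (x : P.X) (v : P.V i) : ℝ :=
  match sm with
  | Smoothing.objective => P.f i (yPart v, x) - μ * ∑ j, Real.log (sPart v j)
  | Smoothing.solution => P.f i (yPart v, x)

/-- `‖[z]⁺‖₁`. -/
def posPartL1 {m : ℕ} (z : Vec m) : ℝ := ∑ j, max (z j) 0

/-- The `ℓ₁`-penalty function at `x`, the second-stage values being based on the points `v i`. -/
def penalty (sm : Smoothing) (μ pen : ℝ) (x : P.X) (v : (i : Fin P.N) → P.V i) : ℝ :=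
  P.f₀ x + ∑ i, P.stageValue sm μ i x (v i) + pen * posPartL1 (P.c₀ x)

/-- The local `ℓ₁`-penalty function `x ↦ φ(x; (xb, vb))`, defined through solution maps `W i` with
reference points `(xb, vb i)`. -/
def localPenalty (sm : Smoothing) (μ pen : ℝ) (W : (i : Fin P.N) → P.X → P.V i) (x : P.X) : ℝ :=
  P.penalty sm μ pen x (fun i => W i x)

/-- `g` is a gradient returned at `x` on the basis of the stationary point `v`: whenever `(x, v)` is
nondegenerate, it is the gradient at `x` of the local second-stage function with reference point
`(x, v)`. Nothing is required at degenerate points. -/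
def IsReturnedGradient (sm : Smoothing) (μ : ℝ) (i : Fin P.N) (x : P.X) (v : P.V i)
    (g : P.X) : Prop :=
  P.IsNondegenerate μ i x v → ∀ r > 0, ∀ W : P.X → P.V i,
    P.IsSolutionMap μ i x v (Metric.ball x r) W →
    HasGradientAt (fun x' => P.stageValue sm μ i x' (W x')) g x

/-- The model `m(x, H, p)`, for second-stage points `v` and second-stage gradients `g`. -/
def model (sm : Smoothing) (μ pen : ℝ) (x : P.X) (v : (i : Fin P.N) → P.V i)
    (g : Fin P.N → P.X) (H : P.X →L[ℝ] P.X) (p : P.X) : ℝ :=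
  P.f₀ x + ∑ i, P.stageValue sm μ i x (v i) + inner ℝ (gradient P.f₀ x + ∑ i, g i) p +
    (1 / 2) * inner ℝ p (H p) + pen * posPartL1 (P.c₀ x + fderiv ℝ P.c₀ x p)

/-- A (warm-started) solver for the subproblems: `sol i x w` is the output for the `i`-th subproblem
with parameter `x` when started from `w`. -/
abbrev Solver := (i : Fin P.N) → P.X → P.V i → P.V i

end TwoStageProblem

/-- Parameters of the trust-region method. -/
structure TrustRegionParams where
  (Δ₀ Δbar pen η₁ η₂ γ₁ γ₂ γ₃ : ℝ)

/-- The requirements on the parameters of the trust-region method. -/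
structure TrustRegionParams.Valid (a : TrustRegionParams) : Prop where
  Δ₀_pos : 0 < a.Δ₀
  Δ₀_le : a.Δ₀ ≤ a.Δbar
  pen_pos : 0 < a.pen
  η₁_pos : 0 < a.η₁
  η₁_le : a.η₁ ≤ a.η₂
  η₂_lt : a.η₂ < 1
  γ₃_inv_pos : 0 < 1 / a.γ₃
  γ₁_ge : 1 / a.γ₃ ≤ a.γ₁
  γ₁_le : a.γ₁ ≤ a.γ₂
  γ₂_lt : a.γ₂ < 1
  γ₃_gt : 1 < a.γ₃

/-- The quantities that occur in the trust-region method: iterates `x k`, warm-start points `v k`,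
trial steps `p k`, outputs `vt k` of the subproblem solver at the trial points `x k + p k`,
second-stage gradients `g k`, Hessian approximations `H k` and radii `Δ k`. The points `start` are
the starting points of the first call of the subproblem solver. -/
structure Trajectory (P : TwoStageProblem) where
  start : (i : Fin P.N) → P.V i
  x : ℕ → P.X
  v : ℕ → (i : Fin P.N) → P.V i
  p : ℕ → P.X
  vt : ℕ → (i : Fin P.N) → P.V i
  g : ℕ → Fin P.N → P.X
  H : ℕ → P.X →L[ℝ] P.X
  Δ : ℕ → ℝ

namespace Trajectory

variable {P : TwoStageProblem} (T : Trajectory P)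

/-- The model of the `k`-th iteration. -/
def modelAt (sm : Smoothing) (μ pen : ℝ) (k : ℕ) (p : P.X) : ℝ :=
  P.model sm μ pen (T.x k) (T.v k) (T.g k) (T.H k) p

/-- The performance ratio `ρᵏ` (equal to `0` if the denominator vanishes). -/
def ratio (sm : Smoothing) (μ pen : ℝ) (k : ℕ) : ℝ :=
  (P.penalty sm μ pen (T.x k) (T.v k) - P.penalty sm μ pen (T.x k + T.p k) (T.vt k)) /
    (T.modelAt sm μ pen k 0 - T.modelAt sm μ pen k (T.p k))

/-- `T` is an infinite run of the trust-region `Sℓ₁QP` master solver with the subproblem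
solver `sol`. -/
structure IsRun (sm : Smoothing) (μ : ℝ) (a : TrustRegionParams) (sol : P.Solver) : Prop where
  init_v : ∀ i, T.v 0 i = sol i (T.x 0) (T.start i)
  init_Δ : T.Δ 0 = a.Δ₀
  grad : ∀ k i, P.IsReturnedGradient sm μ i (T.x k) (T.v k i) (T.g k i)
  hess_symm : ∀ k, IsSelfAdjoint (T.H k)
  step_mem : ∀ k, ‖T.p k‖ ≤ T.Δ k
  step_min : ∀ k, ∀ q : P.X, ‖q‖ ≤ T.Δ k →
    T.modelAt sm μ a.pen k (T.p k) ≤ T.modelAt sm μ a.pen k q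
  /-- The run does not terminate. -/
  step_ne : ∀ k, T.p k ≠ 0
  trial : ∀ k i, T.vt k i = sol i (T.x k + T.p k) (T.v k i)
  accept : ∀ k, a.η₁ ≤ T.ratio sm μ a.pen k →
    T.x (k + 1) = T.x k + T.p k ∧ T.v (k + 1) = T.vt k
  reject : ∀ k, T.ratio sm μ a.pen k < a.η₁ → T.x (k + 1) = T.x k ∧ T.v (k + 1) = T.v k
  radius_increase : ∀ k, a.η₂ ≤ T.ratio sm μ a.pen k →
    T.Δ (k + 1) ∈ Icc (min (a.γ₃ * T.Δ k) a.Δbar) a.Δbar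
  radius_keep : ∀ k, T.ratio sm μ a.pen k ∈ Ico a.η₁ a.η₂ →
    T.Δ (k + 1) ∈ Icc (a.γ₂ * T.Δ k) (T.Δ k)
  radius_decrease : ∀ k, T.ratio sm μ a.pen k < a.η₁ →
    T.Δ (k + 1) ∈ Icc (a.γ₁ * T.Δ k) (a.γ₂ * T.Δ k)

/-- Full recourse: for every `x` that is sent to the subproblems in the course of the run, the
subproblems are feasible and the subproblem solver returns KKT points. -/
structure FullRecourse (μ : ℝ) (sol : P.Solver) : Prop where
  init_feasible : ∀ i, ∃ y, ∀ j, P.c i (y, T.x 0) j ≤ 0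
  init_kkt : ∀ i, P.IsKKTPoint μ i (T.x 0) (sol i (T.x 0) (T.start i))
  trial_feasible : ∀ k i, ∃ y, ∀ j, P.c i (y, T.x k + T.p k) j ≤ 0
  trial_kkt : ∀ k i, P.IsKKTPoint μ i (T.x k + T.p k) (sol i (T.x k + T.p k) (T.v k i))

/-- Consistency of the warm-started subproblem solver near nondegenerate stationary points, for a
radius `r₂` as in `IsGraphRadius`. That such radii exist is a consequence of the implicit function
theorem and is not part of the assumption (hence the premise `∃ r₂, …`). -/
def ConsistentOutput (μ : ℝ) (sol : P.Solver) : Prop :=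
  ∀ (i : Fin P.N) (xb : P.X) (vb : P.V i), P.IsNondegenerate μ i xb vb →
    (∃ r₂, P.IsGraphRadius μ i xb vb r₂) →
    ∃ r₂, P.IsGraphRadius μ i xb vb r₂ ∧ ∃ r₃ > 0,
      ∀ k, P.InBall xb vb r₃ (T.x k) (T.v k i) →
        ∀ p : P.X, ‖p‖ ≤ r₃ →
          P.InBall xb vb r₂ (T.x k + p) (sol i (T.x k + p) (T.v k i))

end Trajectory

/-- `∂φ(x)`: all `g` such that `gᵀ d` is at most the one-sided directional derivative of `φ` at `x`
along `d` (which has to exist), for every `d`. -/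
def subdifferential {n : ℕ} (φ : Vec n → ℝ) (x : Vec n) : Set (Vec n) :=
  {g | ∀ d : Vec n, ∃ l : ℝ,
    Tendsto (fun t : ℝ => (φ (x + t • d) - φ x) / t) (𝓝[>] 0) (𝓝 l) ∧ inner ℝ g d ≤ l}

/-- `x` is stationary for `φ`: the element of minimal norm of `∂φ(x)` is zero. -/
def IsStationaryPoint {n : ℕ} (φ : Vec n → ℝ) (x : Vec n) : Prop :=
  ∃ g ∈ subdifferential φ x, (∀ g' ∈ subdifferential φ x, ‖g‖ ≤ ‖g'‖) ∧ g = 0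

end

noncomputable section

/-! At the limit point the slacks are positive: they are nonnegative by closedness, and
complementarity `s ∘ λ = μ e` with `μ > 0` excludes zero. By the implicit function theorem the zero
set of the optimality map near the limit is the graph of a `C¹` map `W`. As long as iterates stay
close to the limit and on this graph, the method is a trust-region method for a single function, the
composite `h + pen * ‖[c]⁺‖₁` with `h` of class `C¹`.

If the limit is not stationary, some directional derivative is negative. The linearized change is
then negative along some `q`, at nearby points as well, and convexity gives a model decrease of at
least `κ * min Δ D₀` (`exists_sufficient_decrease`). The uniform first-order expansion makes all
sufficiently short steps very successful.

The difficulty is that a long step may leave the graph, and nothing is known about the second-stage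
values on another branch. Acceptance is still measured by the penalty values of the run, which
decrease and stay above the value at the limit. From an iterate close enough to the limit, both in
position and in value, an accepted long step would use up more decrease than is left, while accepted
short steps decrease the penalty in proportion to their length and so cannot travel far. Hence the
run stays on the graph forever, the radii are bounded below, and the convergence of the penalty
values forbids further accepted steps. Perpetual rejection drives the radii to zero, a contradiction
(`TrustRegionParams.Valid.not_sufficient_decrease`). -/

theorem ContDiff.gradient_param {E F : Type*} [NormedAddCommGroup E] [NormedSpace ℝ E]
    [NormedAddCommGroup F] [InnerProductSpace ℝ F] [CompleteSpace F]
    {f : E → F → ℝ} {g : E → F} (hf : ContDiff ℝ 2 (Function.uncurry f)) (hg : ContDiff ℝ 1 g) :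
    ContDiff ℝ 1 (fun x => gradient (f x) (g x)) := by
  -- The inverse Riesz map is conjugate-linear; over the reals it is repackaged as a linear map.
  let D : StrongDual ℝ F →L[ℝ] F :=
    { toFun := (InnerProductSpace.toDual ℝ F).symm
      map_add' := fun a b => map_add _ a b
      map_smul' := fun r a => by simp
      cont := (InnerProductSpace.toDual ℝ F).symm.continuous }
  exact D.contDiff.comp (ContDiff.fderiv hf hg (by norm_num))

theorem ContinuousLinearMap.isInvertible_of_bijective {E F : Type*} [NormedAddCommGroup E]
    [NormedSpace ℝ E] [CompleteSpace E] [NormedAddCommGroup F] [NormedSpace ℝ F] [CompleteSpace F]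
    {A : E →L[ℝ] F} (h : Function.Bijective A) : A.IsInvertible :=
  ⟨ContinuousLinearEquiv.ofBijective A (LinearMap.ker_eq_bot.2 h.1) (LinearMap.range_eq_top.2 h.2),
    by ext; rfl⟩

/-! ### The optimality map and its zero set near nondegenerate points. -/

namespace TwoStageProblem

variable {P : TwoStageProblem}

theorem IsSmooth.contDiff_fc {sm : Smoothing} (h : P.IsSmooth sm) (i : Fin P.N) :
    ContDiff ℝ 2 (P.f i) ∧ ContDiff ℝ 2 (P.c i) := by
  cases sm with
  | objective => exact ⟨(h.objective rfl i).1, (h.objective rfl i).2.2.1⟩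
  | solution =>
    exact ⟨(h.solution rfl i).1.of_le (by norm_num), (h.solution rfl i).2.of_le (by norm_num)⟩

theorem IsSmooth.contDiff_kktMap {sm : Smoothing} (h : P.IsSmooth sm) (μ : ℝ) (i : Fin P.N) :
    ContDiff ℝ 1 (fun q : P.X × P.V i => P.kktMap μ i q.1 q.2) := by
  obtain ⟨hf, hc⟩ := h.contDiff_fc i
  have hf1 := hf.of_le (m := 1) (by norm_num)
  have hc1 := hc.of_le (m := 1) (by norm_num)
  unfold kktMap
  refine .prodMk ?_ (.prodMk ?_ (.prodMk ?_ (.prodMk ?_ ?_)))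
  · refine ContDiff.gradient_param (f := fun (q : P.X × P.V i) y => P.lagrangian i y (xPart q.2)
      (sPart q.2) (lamPart q.2) (etaPart q.2) q.1) (g := fun q => yPart q.2) ?_ (by fun_prop)
    unfold lagrangian Function.uncurry
    refine ContDiff.add (ContDiff.add ?_ (ContDiff.inner ℝ ?_ ?_)) (ContDiff.inner ℝ ?_ ?_) <;>
      fun_prop
  · refine ContDiff.gradient_param (f := fun (q : P.X × P.V i) xt => P.lagrangian i (yPart q.2) xt
      (sPart q.2) (lamPart q.2) (etaPart q.2) q.1) (g := fun q => xPart q.2) ?_ (by fun_prop)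
    unfold lagrangian Function.uncurry
    refine ContDiff.add (ContDiff.add ?_ (ContDiff.inner ℝ ?_ ?_)) (ContDiff.inner ℝ ?_ ?_) <;>
      fun_prop
  · rw [contDiff_euclidean]
    intro j
    simp only
    have h1 : ContDiff ℝ 1 fun q : P.X × P.V i => sPart q.2 := by fun_prop
    have h2 : ContDiff ℝ 1 fun q : P.X × P.V i => lamPart q.2 := by fun_prop
    exact ((contDiff_euclidean.1 h1 j).mul (contDiff_euclidean.1 h2 j)).sub contDiff_const
  · fun_prop
  · fun_prop

/-- This form makes joint continuity in `(x, v)` visible and is the one in which the implicit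
function theorem expects the partial derivative. -/
theorem fderiv_kktMap_eq_comp_inr {sm : Smoothing} (h : P.IsSmooth sm) (μ : ℝ) (i : Fin P.N)
    (x : P.X) (v : P.V i) :
    fderiv ℝ (fun w => P.kktMap μ i x w) v =
      fderiv ℝ (fun q : P.X × P.V i => P.kktMap μ i q.1 q.2) (x, v) ∘L .inr ℝ P.X (P.V i) := by
  have h1 := ((h.contDiff_kktMap μ i).differentiable (by norm_num) (x, v)).hasFDerivAt
  exact (h1.comp v (hasFDerivAt_prodMk_right x v)).fderiv

/-- Invertible operators form an open set, and the partial Jacobian is continuous in `(x, v)`. -/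
theorem JacobianNonsingular.eventually {sm : Smoothing} (h : P.IsSmooth sm) {μ : ℝ} {i : Fin P.N}
    {x : P.X} {v : P.V i} (hJ : P.JacobianNonsingular μ i x v) :
    ∀ᶠ q in 𝓝 (x, v), P.JacobianNonsingular μ i q.1 q.2 := by
  have hcont : Continuous fun q : P.X × P.V i => fderiv ℝ (fun w => P.kktMap μ i q.1 w) q.2 := by
    simp only [fderiv_kktMap_eq_comp_inr h]
    exact ((h.contDiff_kktMap μ i).continuous_fderiv (by norm_num)).clm_comp continuous_const
  obtain ⟨e, he⟩ := ContinuousLinearMap.isInvertible_of_bijective hJ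
  have hn := ContinuousLinearEquiv.nhds e
  rw [he] at hn
  filter_upwards [hcont.continuousAt (x := (x, v)) hn] with q hq
  obtain ⟨e', he'⟩ := hq
  unfold JacobianNonsingular
  change _ = fderiv ℝ (fun w => P.kktMap μ i q.1 w) q.2 at he'
  rw [← he']
  exact e'.bijective

/-- Product types carry the sup metric, so the Euclidean ball has to be compared with the metric
one. -/
theorem dist_lt_of_inBall {i : Fin P.N} {xb : P.X} {vb : P.V i} {r : ℝ} {x : P.X} {v : P.V i}
    (h : P.InBall xb vb r x v) : dist (x, v) (xb, vb) < r := by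
  unfold InBall at h
  have key : ∀ z : ℝ, 0 ≤ z → z ^ 2 ≤ ‖x - xb‖ ^ 2 + ‖yPart v - yPart vb‖ ^ 2 +
      ‖xPart v - xPart vb‖ ^ 2 + ‖sPart v - sPart vb‖ ^ 2 + ‖lamPart v - lamPart vb‖ ^ 2 +
      ‖etaPart v - etaPart vb‖ ^ 2 → z < r := fun z _ hz => (Real.le_sqrt_of_sq_le hz).trans_lt h
  rw [Prod.dist_eq, Prod.dist_eq, Prod.dist_eq, Prod.dist_eq, Prod.dist_eq]
  simp only [max_lt_iff, dist_eq_norm]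
  refine ⟨key _ (norm_nonneg _) ?_, key _ (norm_nonneg _) ?_, key _ (norm_nonneg _) ?_,
    key _ (norm_nonneg _) ?_, key _ (norm_nonneg _) ?_, key _ (norm_nonneg _) ?_⟩ <;>
  nlinarith [sq_nonneg ‖x - xb‖, sq_nonneg ‖yPart v - yPart vb‖, sq_nonneg ‖xPart v - xPart vb‖,
    sq_nonneg ‖sPart v - sPart vb‖, sq_nonneg ‖lamPart v - lamPart vb‖,
    sq_nonneg ‖etaPart v - etaPart vb‖]

theorem eventually_inBall {i : Fin P.N} (xb : P.X) (vb : P.V i) {r : ℝ} (hr : 0 < r) :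
    ∀ᶠ q in 𝓝 (xb, vb), P.InBall xb vb r q.1 q.2 := by
  unfold InBall
  have hc : Continuous fun q : P.X × P.V i => Real.sqrt (‖q.1 - xb‖ ^ 2 +
      ‖yPart q.2 - yPart vb‖ ^ 2 + ‖xPart q.2 - xPart vb‖ ^ 2 + ‖sPart q.2 - sPart vb‖ ^ 2 +
      ‖lamPart q.2 - lamPart vb‖ ^ 2 + ‖etaPart q.2 - etaPart vb‖ ^ 2) := by fun_prop
  refine hc.continuousAt.eventually_lt continuousAt_const ?_
  simpa using hr

/-- The implicit function theorem; it discharges the premise in `ConsistentOutput`. -/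
theorem exists_isGraphRadius {sm : Smoothing} (h : P.IsSmooth sm) {μ : ℝ} {i : Fin P.N}
    {x : P.X} {v : P.V i} (hN : P.IsNondegenerate μ i x v) :
    ∃ r₂, P.IsGraphRadius μ i x v r₂ := by
  obtain ⟨hS, hJ⟩ := hN
  have hS : P.kktMap μ i x v = 0 := hS
  have hC : ContDiffAt ℝ 1 (fun q : P.X × P.V i => P.kktMap μ i q.1 q.2) (x, v) :=
    (h.contDiff_kktMap μ i).contDiffAt
  unfold JacobianNonsingular at hJ
  rw [fderiv_kktMap_eq_comp_inr h] at hJ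
  have hI := ContinuousLinearMap.isInvertible_of_bijective hJ
  have e1 := hC.eventually_apply_implicitFunction one_ne_zero hI
  have e2 := hC.eventually_apply_eq_iff_implicitFunction one_ne_zero hI
  have e3 := (hC.contDiffAt_implicitFunction one_ne_zero hI).eventually (by simp)
  have e4 := hC.implicitFunction_apply_self one_ne_zero hI
  set W := hC.implicitFunction one_ne_zero hI
  obtain ⟨ra, hra, ha⟩ := Metric.eventually_nhds_iff.1 (e1.and e3)
  obtain ⟨rb, hrb, hb⟩ := Metric.eventually_nhds_iff.1 e2
  have hW : ContDiffOn ℝ 1 W (Metric.ball x ra) := fun z hz => (ha hz).2.contDiffWithinAt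
  refine ⟨min ra rb, lt_min hra hrb, ra, min_le_left _ _, W, hW, ⟨hW.continuousOn, ?_, e4⟩, ?_⟩
  · intro z hz
    have := (ha hz).1
    simp only [hS] at this
    exact this
  · intro z w hzw hz
    have hz : P.kktMap μ i z w = 0 := hz
    have := (hb ((dist_lt_of_inBall hzw).trans_le (min_le_right _ _))).1
    simp only [hS] at this
    exact (this hz).symm

/-- A vanishing slack would contradict `s j * λ j = μ > 0`. Hence strict positivity survives passage
to limits. -/
theorem IsKKTPoint.of_nonneg {μ : ℝ} (hμ : 0 < μ) {i : Fin P.N} {x : P.X} {v : P.V i}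
    (hS : (x, v) ∈ P.stationarySet μ i) (hs : ∀ j, 0 ≤ sPart v j) : P.IsKKTPoint μ i x v := by
  refine ⟨hS, fun j => (hs j).lt_of_ne' fun h0 => ?_⟩
  have hS : P.kktMap μ i x v = 0 := hS
  have h1 := congrArg (fun w : P.V i => sPart w j) hS
  simp only [kktMap, sPart] at h1
  simp only [sPart] at h0
  simp [h0] at h1
  exact hμ.ne' h1

theorem isClosed_stationarySet {sm : Smoothing} (h : P.IsSmooth sm) (μ : ℝ) (i : Fin P.N) :
    IsClosed (P.stationarySet μ i) :=
  isClosed_eq (h.contDiff_kktMap μ i).continuous continuous_const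

end TwoStageProblem

/-! ### First-order analysis of the composite function `h + pen * ‖[c]⁺‖₁`. -/

/-- Uniform first-order expansion of a `C¹` function near a point. -/
theorem ContDiffAt.exists_uniform_expansion {E F : Type*} [NormedAddCommGroup E]
    [NormedSpace ℝ E] [NormedAddCommGroup F] [NormedSpace ℝ F] {f : E → F} {x₀ : E} (hf : ContDiffAt ℝ 1 f x₀)
    {ε : ℝ} (hε : 0 < ε) : ∃ δ > 0, ∀ x p : E, ‖x - x₀‖ < δ → ‖p‖ < δ →
      ‖f (x + p) - f x - fderiv ℝ f x p‖ ≤ ε * ‖p‖ := by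
  -- Strict differentiability gives the expansion with the derivative frozen at `x₀`; continuity of
  -- the derivative then replaces it by the one at `x`. Each costs `ε / 2`.
  have h1 := (hf.hasStrictFDerivAt one_ne_zero).isLittleO.def (half_pos hε)
  have h2 : ContinuousAt (fderiv ℝ f) x₀ :=
    (hf.fderiv_right (m := 0) (by norm_num)).continuousAt
  obtain ⟨δ₁, hδ₁, h1⟩ := Metric.eventually_nhds_iff.1 h1
  obtain ⟨δ₂, hδ₂, h2⟩ := Metric.continuousAt_iff.1 h2 (ε / 2) (half_pos hε)
  refine ⟨min (δ₁ / 2) δ₂, by positivity, fun x p hx hp => ?_⟩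
  have hx1 := hx.trans_le (min_le_left _ _)
  have hx2 := hx.trans_le (min_le_right _ _)
  have hp1 := hp.trans_le (min_le_left _ _)
  have hxp : ‖x + p - x₀‖ < δ₁ := by
    have : x + p - x₀ = (x - x₀) + p := by abel
    rw [this]
    linarith [norm_add_le (x - x₀) p]
  have h3 := @h1 (x + p, x) (by
    rw [Prod.dist_eq, max_lt_iff, dist_eq_norm, dist_eq_norm]
    exact ⟨hxp, by linarith⟩)
  have h4 := @h2 x (by rwa [dist_eq_norm])
  rw [dist_eq_norm] at h4
  simp only [add_sub_cancel_left] at h3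
  have h5 := (fderiv ℝ f x - fderiv ℝ f x₀).le_of_opNorm_le h4.le p
  have h6 : f (x + p) - f x - fderiv ℝ f x p =
      (f (x + p) - f x - fderiv ℝ f x₀ p) - (fderiv ℝ f x - fderiv ℝ f x₀) p := by
    simp only [sub_apply]
    abel
  rw [h6]
  linarith [norm_sub_le (f (x + p) - f x - fderiv ℝ f x₀ p) ((fderiv ℝ f x - fderiv ℝ f x₀) p)]

/-- If `u 0 ≠ 0`, the positive part is locally `0` or `u`. At a zero of `u`, division by `t > 0`
commutes with the maximum and the limit is `max u' 0`. -/
theorem exists_tendsto_slope_max_zero {u : ℝ → ℝ} {u' : ℝ} (hu : HasDerivAt u u' 0) :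
    ∃ l, Tendsto (fun t => (max (u t) 0 - max (u 0) 0) / t) (𝓝[>] 0) (𝓝 l) := by
  have hs : Tendsto (fun t => (u t - u 0) / t) (𝓝[>] 0) (𝓝 u') := by
    refine (hu.tendsto_slope_zero_right).congr fun t => ?_
    simp [div_eq_inv_mul]
  have hc : Tendsto u (𝓝[>] 0) (𝓝 (u 0)) := hu.continuousAt.tendsto.mono_left nhdsWithin_le_nhds
  rcases lt_trichotomy (u 0) 0 with h | h | h
  · refine ⟨0, tendsto_const_nhds.congr' ?_⟩
    filter_upwards [hc.eventually_lt_const h] with t ht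
    simp [max_eq_right ht.le, max_eq_right h.le]
  · refine ⟨max u' 0, (hs.max tendsto_const_nhds).congr' ?_⟩
    filter_upwards [self_mem_nhdsWithin] with t ht
    have ht : 0 < t := ht
    rw [h, max_self, sub_zero, sub_zero, ← max_div_div_right ht.le, zero_div]
  · refine ⟨u', hs.congr' ?_⟩
    filter_upwards [hc.eventually_const_lt h] with t ht
    rw [max_eq_left ht.le, max_eq_left h.le]

namespace TwoStageProblem

variable {E : Type*} [NormedAddCommGroup E] [NormedSpace ℝ E] {m : ℕ}

theorem abs_posPartL1_sub_le (z w : Vec m) : |posPartL1 z - posPartL1 w| ≤ m * ‖z - w‖ := by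
  unfold posPartL1
  rw [← Finset.sum_sub_distrib]
  refine (Finset.abs_sum_le_sum_abs _ _).trans ?_
  have : ∀ j ∈ Finset.univ, |max (z j) 0 - max (w j) 0| ≤ ‖z - w‖ := fun j _ =>
    (abs_max_sub_max_le_abs _ _ _).trans (PiLp.norm_apply_le (z - w) j)
  simpa using Finset.sum_le_sum this

theorem continuous_posPartL1 : Continuous (posPartL1 : Vec m → ℝ) := by
  unfold posPartL1
  fun_prop

theorem posPartL1_add_smul_le (z w : Vec m) {τ : ℝ} (h0 : 0 ≤ τ) (h1 : τ ≤ 1) :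
    posPartL1 (z + τ • w) ≤ (1 - τ) * posPartL1 z + τ * posPartL1 (z + w) := by
  unfold posPartL1
  rw [Finset.mul_sum, Finset.mul_sum, ← Finset.sum_add_distrib]
  refine Finset.sum_le_sum fun j _ => max_le ?_ ?_
  · simp only [PiLp.add_apply, PiLp.smul_apply, smul_eq_mul]
    nlinarith [le_max_left (z j) 0, le_max_left (z j + w j) 0]
  · exact add_nonneg (mul_nonneg (by linarith) (le_max_right _ _))
      (mul_nonneg h0 (le_max_right _ _))

/-- The first-order model, at `x`, of the change of `h + pen * ‖[c]⁺‖₁`. -/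
def linearizedChange (pen : ℝ) (h : E → ℝ) (c : E → Vec m) (x p : E) : ℝ :=
  fderiv ℝ h x p + pen * (posPartL1 (c x + fderiv ℝ c x p) - posPartL1 (c x))

section penaltyFunction

variable {pen : ℝ} {h : E → ℝ} {c : E → Vec m} {x₀ : E}

/-- The error in `c` passes through the `m`-Lipschitz function `posPartL1`, hence the tolerance is
divided by `pen * m + 1`. Uniformity in `x` matters because the expansion is applied at the
iterates. -/
theorem exists_abs_sub_linearizedChange_le (hpen : 0 ≤ pen) (hh : ContDiffAt ℝ 1 h x₀)
    (hc : ContDiffAt ℝ 1 c x₀) {ε : ℝ} (hε : 0 < ε) :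
    ∃ δ > 0, ∀ x p : E, ‖x - x₀‖ < δ → ‖p‖ < δ →
      |(h (x + p) + pen * posPartL1 (c (x + p))) - (h x + pen * posPartL1 (c x)) -
        linearizedChange pen h c x p| ≤ ε * ‖p‖ := by
  have hK : 0 < pen * m + 1 := by positivity
  obtain ⟨δ₁, hδ₁, h1⟩ := hh.exists_uniform_expansion (half_pos hε)
  obtain ⟨δ₂, hδ₂, h2⟩ := hc.exists_uniform_expansion (div_pos (half_pos hε) hK)
  refine ⟨min δ₁ δ₂, lt_min hδ₁ hδ₂, fun x p hx hp => ?_⟩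
  have e1 := h1 x p (hx.trans_le (min_le_left _ _)) (hp.trans_le (min_le_left _ _))
  have e2 := h2 x p (hx.trans_le (min_le_right _ _)) (hp.trans_le (min_le_right _ _))
  have e3 := abs_posPartL1_sub_le (c (x + p)) (c x + fderiv ℝ c x p)
  rw [← sub_sub] at e3
  have e4 : pen * |posPartL1 (c (x + p)) - posPartL1 (c x + fderiv ℝ c x p)| ≤
      ε / 2 * ‖p‖ := by
    calc _ ≤ pen * (m * (ε / 2 / (pen * m + 1) * ‖p‖)) := by
          gcongr
          exact e3.trans (by gcongr)
      _ = (pen * m / (pen * m + 1)) * (ε / 2 * ‖p‖) := by ring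
      _ ≤ 1 * (ε / 2 * ‖p‖) := by
          gcongr
          rw [div_le_one hK]
          linarith
      _ = _ := one_mul _
  have e5 := abs_mul pen (posPartL1 (c (x + p)) - posPartL1 (c x + fderiv ℝ c x p))
  rw [abs_of_nonneg hpen] at e5
  rw [Real.norm_eq_abs] at e1
  have : (h (x + p) + pen * posPartL1 (c (x + p))) - (h x + pen * posPartL1 (c x)) -
        linearizedChange pen h c x p = (h (x + p) - h x - fderiv ℝ h x p) +
        pen * (posPartL1 (c (x + p)) - posPartL1 (c x + fderiv ℝ c x p)) := by
    unfold linearizedChange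
    ring
  rw [this]
  linarith [abs_add_le (h (x + p) - h x - fderiv ℝ h x p)
    (pen * (posPartL1 (c (x + p)) - posPartL1 (c x + fderiv ℝ c x p)))]

theorem exists_tendsto_directional (hh : DifferentiableAt ℝ h x₀) (hc : DifferentiableAt ℝ c x₀)
    (d : E) : ∃ l, Tendsto (fun t : ℝ => ((h (x₀ + t • d) + pen * posPartL1 (c (x₀ + t • d))) -
      (h x₀ + pen * posPartL1 (c x₀))) / t) (𝓝[>] 0) (𝓝 l) := by
  have hline : HasDerivAt (fun t : ℝ => x₀ + t • d) d 0 := by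
    simpa using ((hasDerivAt_id (0 : ℝ)).smul_const d).const_add x₀
  have hx0 : x₀ + (0 : ℝ) • d = x₀ := by simp
  have dh : HasDerivAt (fun t : ℝ => h (x₀ + t • d)) (fderiv ℝ h x₀ d) 0 := by
    have := hh.hasFDerivAt
    rw [← hx0] at this
    have := this.comp_hasDerivAt (0 : ℝ) hline
    rw [hx0] at this
    exact this
  have dc : ∀ j, HasDerivAt (fun t : ℝ => c (x₀ + t • d) j) (fderiv ℝ c x₀ d j) 0 := by
    intro j
    have := hc.hasFDerivAt
    rw [← hx0] at this
    have := (EuclideanSpace.proj (𝕜 := ℝ) j).hasFDerivAt.comp_hasDerivAt (0 : ℝ)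
      (this.comp_hasDerivAt (0 : ℝ) hline)
    rw [hx0] at this
    exact this
  choose l hl using fun j => exists_tendsto_slope_max_zero (dc j)
  have h1 : Tendsto (fun t : ℝ => (h (x₀ + t • d) - h x₀) / t) (𝓝[>] 0)
      (𝓝 (fderiv ℝ h x₀ d)) := by
    refine (dh.tendsto_slope_zero_right).congr fun t => ?_
    simp [div_eq_inv_mul]
  refine ⟨_, (h1.add ((tendsto_finsetSum Finset.univ fun j _ => hl j).const_mul pen)).congr
    fun t => ?_⟩
  simp only [hx0]
  rw [← Finset.sum_div, Finset.sum_sub_distrib]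
  unfold posPartL1
  ring

/-- For small `t > 0` the true change along `t • d` is below `l / 2 * t`, and the linearization
error is at most `-l / 2 * t`. The `+ 1` in the tolerance avoids division by zero. -/
theorem exists_linearizedChange_neg (hpen : 0 ≤ pen) (hh : ContDiffAt ℝ 1 h x₀)
    (hc : ContDiffAt ℝ 1 c x₀) {d : E} {l : ℝ} (hl : l < 0)
    (hd : Tendsto (fun t : ℝ => ((h (x₀ + t • d) + pen * posPartL1 (c (x₀ + t • d))) -
      (h x₀ + pen * posPartL1 (c x₀))) / t) (𝓝[>] 0) (𝓝 l)) :
    ∃ q, linearizedChange pen h c x₀ q < 0 := by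
  have hε : 0 < -l / 2 / (‖d‖ + 1) := by
    have := norm_nonneg d
    apply div_pos <;> linarith
  obtain ⟨δ, hδ, happ⟩ := exists_abs_sub_linearizedChange_le hpen hh hc hε
  have h1 := hd.eventually_lt_const (show l < l / 2 by linarith)
  have h2 : ∀ᶠ t : ℝ in 𝓝[>] 0, ‖t • d‖ < δ := by
    have : Tendsto (fun t : ℝ => ‖t • d‖) (𝓝 0) (𝓝 ‖(0 : ℝ) • d‖) :=
      Continuous.tendsto (by fun_prop) _
    exact (this.mono_left nhdsWithin_le_nhds).eventually_lt_const (by simpa using hδ)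
  obtain ⟨t, ht1, ht2, ht0⟩ := (h1.and (h2.and self_mem_nhdsWithin)).exists
  have ht0 : 0 < t := ht0
  refine ⟨t • d, ?_⟩
  have h3 := happ x₀ (t • d) (by simpa using hδ) ht2
  rw [div_lt_iff₀ ht0] at ht1
  have h4 : -l / 2 / (‖d‖ + 1) * ‖t • d‖ ≤ -l / 2 * t := by
    rw [norm_smul, Real.norm_of_nonneg ht0.le]
    have hd0 := norm_nonneg d
    have : ‖d‖ / (‖d‖ + 1) ≤ 1 := by rw [div_le_one (by positivity)]; linarith
    calc _ = (-l / 2 * t) * (‖d‖ / (‖d‖ + 1)) := by ring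
      _ ≤ (-l / 2 * t) * 1 := by
        gcongr
        exact mul_nonneg (by linarith) ht0.le
      _ = _ := mul_one _
  linarith [(abs_le.1 h3).1]

/-- The linearized change is convex in the step and vanishes at step zero. -/
theorem linearizedChange_smul_le (hpen : 0 ≤ pen) (x q : E) {τ : ℝ} (h0 : 0 ≤ τ) (h1 : τ ≤ 1) :
    linearizedChange pen h c x (τ • q) ≤ τ * linearizedChange pen h c x q := by
  unfold linearizedChange
  have := mul_le_mul_of_nonneg_left (posPartL1_add_smul_le (c x) (fderiv ℝ c x q) h0 h1) hpen
  simp only [map_smul, smul_eq_mul]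
  linarith

theorem continuousAt_linearizedChange (hh : ContDiffAt ℝ 1 h x₀) (hc : ContDiffAt ℝ 1 c x₀)
    (q : E) : ContinuousAt (fun x => linearizedChange pen h c x q) x₀ := by
  have e1 : ContinuousAt (fderiv ℝ h) x₀ :=
    (hh.fderiv_right (m := 0) (by norm_num)).continuousAt
  have e2 : ContinuousAt (fderiv ℝ c) x₀ :=
    (hc.fderiv_right (m := 0) (by norm_num)).continuousAt
  have e3 := hc.continuousAt
  unfold linearizedChange
  refine (e1.clm_apply continuousAt_const).add (continuousAt_const.mul (.sub ?_ ?_))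
  · exact continuous_posPartL1.continuousAt.comp (e3.add (e2.clm_apply continuousAt_const))
  · exact continuous_posPartL1.continuousAt.comp e3

end penaltyFunction

/-- Sufficient decrease of the model near a point with a descent direction. -/
theorem exists_sufficient_decrease {E : Type*} [NormedAddCommGroup E] [InnerProductSpace ℝ E]
    {pen : ℝ} {h : E → ℝ} {c : E → Vec m} {x₀ q : E} (hpen : 0 ≤ pen) (hh : ContDiffAt ℝ 1 h x₀)
    (hc : ContDiffAt ℝ 1 c x₀) (hq : linearizedChange pen h c x₀ q < 0) (C : ℝ) :
    ∃ κ > 0, ∃ Δ₀ > 0, ∀ᶠ x in 𝓝 x₀, ∀ H : E →L[ℝ] E, ‖H‖ ≤ C → ∀ Δ > 0,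
      ∃ p, ‖p‖ ≤ Δ ∧ linearizedChange pen h c x p + 1 / 2 * inner ℝ p (H p) ≤ -(κ * min Δ Δ₀) := by
  set b := -linearizedChange pen h c x₀ q / 2 with hb
  have hb0 : 0 < b := by rw [hb]; linarith
  have hn : 0 < ‖q‖ + 1 := by positivity
  have hD : 0 < |C| * (‖q‖ + 1) ^ 2 + 1 := by positivity
  -- The first bound makes `τ ≤ 1`, so that convexity applies. The second makes the quadratic term
  -- at most `τ * b / 2`, half of the linear gain `τ * b`.
  set Δ₀ := min (‖q‖ + 1) (b * (‖q‖ + 1) / (|C| * (‖q‖ + 1) ^ 2 + 1)) with hΔ₀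
  have hΔ₀pos : 0 < Δ₀ := by positivity
  refine ⟨b / 2 / (‖q‖ + 1), by positivity, Δ₀, hΔ₀pos, ?_⟩
  have hev := (continuousAt_linearizedChange (pen := pen) hh hc q).eventually_lt_const
    (show linearizedChange pen h c x₀ q < -b by rw [hb]; linarith)
  filter_upwards [hev] with x hx H hH Δ hΔ
  set τ := min Δ Δ₀ / (‖q‖ + 1) with hτ
  have hm : 0 < min Δ Δ₀ := lt_min hΔ hΔ₀pos
  have hτ0 : 0 ≤ τ := by positivity
  have hτ1 : τ ≤ 1 := by
    rw [hτ, div_le_one hn]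
    exact (min_le_right _ _).trans (min_le_left _ _)
  have hτ2 : τ * (|C| * (‖q‖ + 1) ^ 2 + 1) ≤ b := by
    have : min Δ Δ₀ ≤ b * (‖q‖ + 1) / (|C| * (‖q‖ + 1) ^ 2 + 1) :=
      (min_le_right _ _).trans (min_le_right _ _)
    rw [le_div_iff₀ hD] at this
    rw [hτ, div_mul_eq_mul_div, div_le_iff₀ hn]
    exact this
  refine ⟨τ • q, ?_, ?_⟩
  · rw [norm_smul, Real.norm_of_nonneg hτ0]
    calc τ * ‖q‖ ≤ τ * (‖q‖ + 1) := by gcongr; linarith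
      _ = min Δ Δ₀ := by rw [hτ]; field_simp
      _ ≤ Δ := min_le_left _ _
  · have h1 := linearizedChange_smul_le (h := h) (c := c) hpen x q hτ0 hτ1
    have h2 : inner ℝ (τ • q) (H (τ • q)) ≤ τ * (τ * (|C| * (‖q‖ + 1) ^ 2 + 1)) := by
      have e1 := real_inner_le_norm (τ • q) (H (τ • q))
      have e2 := H.le_of_opNorm_le (hH.trans (le_abs_self C)) (τ • q)
      rw [norm_smul, Real.norm_of_nonneg hτ0] at e1 e2
      have e3 : τ * ‖q‖ * ‖H (τ • q)‖ ≤ τ * ‖q‖ * (|C| * (τ * ‖q‖)) := by gcongr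
      have e4 : ‖q‖ ^ 2 ≤ (‖q‖ + 1) ^ 2 := by gcongr; linarith
      have e5 : τ * ‖q‖ * (|C| * (τ * ‖q‖)) = τ * (τ * (|C| * ‖q‖ ^ 2)) := by ring
      have e6 : τ * (τ * (|C| * ‖q‖ ^ 2)) ≤ τ * (τ * (|C| * (‖q‖ + 1) ^ 2 + 1)) := by
        gcongr
        have := mul_le_mul_of_nonneg_left e4 (abs_nonneg C)
        linarith
      linarith
    have h3 : τ * (τ * (|C| * (‖q‖ + 1) ^ 2 + 1)) ≤ τ * b := by gcongr
    have h4 : τ * linearizedChange pen h c x q ≤ τ * (-b) := by gcongr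
    have h5 : b / 2 / (‖q‖ + 1) * min Δ Δ₀ = τ * b / 2 := by rw [hτ]; ring
    rw [h5]
    linarith

end TwoStageProblem

/-! ### The abstract trust-region argument. -/

/-- A trust-region iteration cannot have arbitrarily good iterates near a point around which every
accepted step yields sufficient decrease and all sufficiently short steps are very successful. -/
theorem TrustRegionParams.Valid.not_sufficient_decrease {E : Type*} [NormedAddCommGroup E]
    {a : TrustRegionParams} (ha : a.Valid) {x p : ℕ → E} {Δ φ ρ : ℕ → ℝ} {φinf κ D δ : ℝ} {x₀ : E}
    {G : ℕ → Prop} (hκ : 0 < κ) (hD : 0 < D) (hδ : 0 < δ)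
    (hΔ0 : Δ 0 = a.Δ₀) (hstep : ∀ k, ‖p k‖ ≤ Δ k)
    (hinc : ∀ k, a.η₂ ≤ ρ k → Δ (k + 1) ∈ Icc (min (a.γ₃ * Δ k) a.Δbar) a.Δbar)
    (hkeep : ∀ k, ρ k ∈ Ico a.η₁ a.η₂ → Δ (k + 1) ∈ Icc (a.γ₂ * Δ k) (Δ k))
    (hdec : ∀ k, ρ k < a.η₁ → Δ (k + 1) ∈ Icc (a.γ₁ * Δ k) (a.γ₂ * Δ k))
    (hacc : ∀ k, a.η₁ ≤ ρ k → x (k + 1) = x k + p k)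
    (hrej : ∀ k, ρ k < a.η₁ → x (k + 1) = x k)
    (hφ : Antitone φ) (hbdd : ∀ k, φinf ≤ φ k)
    (hpred : ∀ k, G k → a.η₁ ≤ ρ k → κ * min (Δ k) D ≤ φ k - φ (k + 1))
    (hratio : ∀ k, G k → Δ k ≤ D → a.η₂ ≤ ρ k)
    (hGacc : ∀ k, G k → a.η₁ ≤ ρ k → Δ k ≤ D → ‖x (k + 1) - x₀‖ < δ → G (k + 1))
    (hGrej : ∀ k, G k → ρ k < a.η₁ → G (k + 1))
    (hfreq : ∀ ε > 0, ∃ k, G k ∧ ‖x k - x₀‖ < ε ∧ φ k < φinf + ε) : False := by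
  have hγ₁ : 0 < a.γ₁ := ha.γ₃_inv_pos.trans_le ha.γ₁_ge
  have hγ₂ : 0 < a.γ₂ := hγ₁.trans_le ha.γ₁_le
  have hγ₃ := ha.γ₃_gt
  have hγ₂lt := ha.γ₂_lt
  have hγ₁lt : a.γ₁ < 1 := ha.γ₁_le.trans_lt hγ₂lt
  have hΔbar : 0 < a.Δbar := ha.Δ₀_pos.trans_le ha.Δ₀_le
  have hΔ : ∀ k, 0 < Δ k ∧ Δ k ≤ a.Δbar := by
    intro k
    induction k with
    | zero => rw [hΔ0]; exact ⟨ha.Δ₀_pos, ha.Δ₀_le⟩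
    | succ k ih =>
      obtain ⟨ih1, ih2⟩ := ih
      rcases lt_or_ge (ρ k) a.η₁ with h | h
      · obtain ⟨h1, h2⟩ := hdec k h
        exact ⟨(mul_pos hγ₁ ih1).trans_le h1, by nlinarith⟩
      rcases lt_or_ge (ρ k) a.η₂ with h' | h'
      · obtain ⟨h1, h2⟩ := hkeep k ⟨h, h'⟩
        exact ⟨(mul_pos hγ₂ ih1).trans_le h1, h2.trans ih2⟩
      · obtain ⟨h1, h2⟩ := hinc k h'
        exact ⟨(lt_min (by positivity) hΔbar).trans_le h1, h2⟩
  have hΔle : ∀ k, a.η₂ ≤ ρ k → Δ k ≤ Δ (k + 1) := by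
    intro k h
    refine le_trans (le_min ?_ (hΔ k).2) (hinc k h).1
    nlinarith [(hΔ k).1]
  -- The remaining decrease `κ * D` excludes accepted long steps; `δ / 2` and `κ * δ / 2` keep all
  -- later iterates within `δ` of `x₀`.
  obtain ⟨k₀, hG₀, hx₀, hφ₀⟩ := hfreq (min (κ * D) (min (δ / 2) (κ * δ / 2))) (by positivity)
  have hφ₀D : φ k₀ < φinf + κ * D := hφ₀.trans_le (by gcongr; exact min_le_left _ _)
  have hφ₀δ : φ k₀ < φinf + κ * δ / 2 := hφ₀.trans_le (by
    gcongr; exact (min_le_right _ _).trans (min_le_right _ _))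
  have hx₀δ : ‖x k₀ - x₀‖ < δ / 2 :=
    hx₀.trans_le ((min_le_right _ _).trans (min_le_left _ _))
  -- An accepted step with radius above `D` would lower `φ` by at least `κ * D`, below its lower
  -- bound `φinf`.
  have hshort : ∀ k, k₀ ≤ k → G k → a.η₁ ≤ ρ k → Δ k ≤ D := by
    intro k hk hG h
    by_contra! hlt
    have h1 := hpred k hG h
    rw [min_eq_right hlt.le] at h1
    linarith [hbdd (k + 1), hφ hk]
  -- Each accepted step lowers `φ` by at least `κ * Δ k ≥ κ * ‖p k‖`; summation bounds the distance
  -- travelled by the decrease achieved.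
  have hG : ∀ k, k₀ ≤ k → G k ∧ κ * ‖x k - x k₀‖ ≤ φ k₀ - φ k := by
    intro k hk
    induction k, hk using Nat.le_induction with
    | base => simpa using hG₀
    | succ k hk ih =>
      obtain ⟨ih1, ih2⟩ := ih
      rcases lt_or_ge (ρ k) a.η₁ with h | h
      · refine ⟨hGrej k ih1 h, ?_⟩
        rw [hrej k h]
        linarith [hφ (Nat.le_succ k)]
      · have hs := hshort k hk ih1 h
        have h1 := hpred k ih1 h
        rw [min_eq_left hs] at h1
        have h2 : ‖x (k + 1) - x k₀‖ ≤ ‖x k - x k₀‖ + Δ k := by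
          rw [hacc k h, add_sub_right_comm]
          exact (norm_add_le _ _).trans (by gcongr; exact hstep k)
        have h3 : κ * ‖x (k + 1) - x k₀‖ ≤ φ k₀ - φ (k + 1) := by
          have := mul_le_mul_of_nonneg_left h2 hκ.le
          linarith
        refine ⟨hGacc k ih1 h hs ?_, h3⟩
        have h4 : ‖x (k + 1) - x k₀‖ < δ / 2 := by
          have : κ * ‖x (k + 1) - x k₀‖ < κ * (δ / 2) := by linarith [hbdd (k + 1)]
          exact lt_of_mul_lt_mul_left this hκ.le
        linarith [norm_sub_le_norm_sub_add_norm_sub (x (k + 1)) (x k₀) x₀]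
  -- Radii up to `D` do not shrink, since such steps are very successful; larger ones shrink at most
  -- by the factor `γ₁`.
  set d := min (a.γ₁ * D) (Δ k₀) with hd
  have hd0 : 0 < d := lt_min (by positivity) (hΔ k₀).1
  have hlow : ∀ k, k₀ ≤ k → d ≤ Δ k := by
    intro k hk
    induction k, hk using Nat.le_induction with
    | base => exact min_le_right _ _
    | succ k hk ih =>
      rcases le_or_gt (Δ k) D with h | h
      · exact ih.trans (hΔle k (hratio k (hG k hk).1 h))
      rcases lt_or_ge (ρ k) a.η₁ with h' | h'
      · refine (min_le_left _ _).trans (le_trans ?_ (hdec k h').1)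
        gcongr
      · exact absurd (hshort k hk (hG k hk).1 h') (not_le.2 h)
  -- The decreases tend to zero, whereas every accepted step gains at least `κ * min d D`.
  -- Eventually all steps are rejected and the radii fall geometrically below `d`.
  have hconv : Tendsto (fun k => φ k - φ (k + 1)) atTop (𝓝 0) := by
    have h1 := tendsto_atTop_ciInf hφ ⟨φinf, by rintro _ ⟨k, rfl⟩; exact hbdd k⟩
    simpa using h1.sub (h1.comp (tendsto_add_atTop_nat 1))
  have hσ : 0 < κ * min d D := by positivity
  obtain ⟨k₁, hk₁⟩ := eventually_atTop.1 ((hconv.eventually_lt_const hσ).and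
    (eventually_ge_atTop k₀))
  have hall : ∀ k, k₁ ≤ k → ρ k < a.η₁ := by
    intro k hk
    by_contra! h
    obtain ⟨h1, h2⟩ := hk₁ k hk
    have h3 := hpred k (hG k h2).1 h
    have h4 : κ * min d D ≤ κ * min (Δ k) D := by
      gcongr
      exact hlow k h2
    linarith
  have hgeo : ∀ j, Δ (k₁ + j) ≤ a.γ₂ ^ j * Δ k₁ := by
    intro j
    induction j with
    | zero => simp
    | succ j ih =>
      have h1 := (hdec (k₁ + j) (hall _ (Nat.le_add_right _ _))).2
      have h2 := mul_le_mul_of_nonneg_left ih hγ₂.le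
      rw [← add_assoc, pow_succ]
      linarith
  have hlim := (tendsto_pow_atTop_nhds_zero_of_lt_one hγ₂.le hγ₂lt).mul_const (Δ k₁)
  rw [zero_mul] at hlim
  obtain ⟨j, hj⟩ := (hlim.eventually_lt_const hd0).exists
  have hk₀₁ : k₀ ≤ k₁ := (hk₁ k₁ le_rfl).2
  linarith [hgeo j, hlow (k₁ + j) (by omega)]

/-! ### The local penalty function along solution maps. -/

namespace TwoStageProblem

variable {P : TwoStageProblem}

theorem IsSmooth.contDiffAt_stageValue {sm : Smoothing} (h : P.IsSmooth sm) (μ : ℝ) {i : Fin P.N}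
    {x : P.X} {v : P.V i} (hs : ∀ j, 0 < sPart v j) :
    ContDiffAt ℝ 1 (fun q : P.X × P.V i => P.stageValue sm μ i q.1 q.2) (x, v) := by
  have hf := (h.contDiff_fc i).1.of_le (m := 1) (by norm_num)
  have hf' : ContDiff ℝ 1 fun q : P.X × P.V i => P.f i (yPart q.2, q.1) := by fun_prop
  cases sm with
  | solution => exact hf'.contDiffAt
  | objective =>
    refine hf'.contDiffAt.sub (contDiffAt_const.mul (ContDiffAt.sum fun j _ => ?_))
    have h1 : ContDiff ℝ 1 fun q : P.X × P.V i => sPart q.2 := by fun_prop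
    exact (contDiff_euclidean.1 h1 j).contDiffAt.log (hs j).ne'

theorem IsSmooth.continuousAt_penalty {sm : Smoothing} (h : P.IsSmooth sm) (μ pen : ℝ) {x : P.X}
    {v : (i : Fin P.N) → P.V i} (hs : ∀ i j, 0 < sPart (v i) j) :
    ContinuousAt (fun q : P.X × ((i : Fin P.N) → P.V i) => P.penalty sm μ pen q.1 q.2) (x, v) := by
  have hf₀ := h.f₀_C1.continuous
  have hc₀ := h.c₀_C1.continuous
  have hst : ∀ i, ContinuousAt (fun q : P.X × ((i : Fin P.N) → P.V i) =>
      P.stageValue sm μ i q.1 (q.2 i)) (x, v) := fun i =>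
    ContinuousAt.comp' (f := fun q : P.X × ((i : Fin P.N) → P.V i) => (q.1, q.2 i)) (x := (x, v))
      (h.contDiffAt_stageValue μ (hs i)).continuousAt (by fun_prop)
  refine .add (.add (by fun_prop) (tendsto_finsetSum _ fun i _ => hst i)) ?_
  exact continuousAt_const.mul
    (continuous_posPartL1.comp (hc₀.comp continuous_fst)).continuousAt

/-- The differentiable part of the local penalty function. -/
def smoothPart (P : TwoStageProblem) (sm : Smoothing) (μ : ℝ) (W : (i : Fin P.N) → P.X → P.V i)
    (x : P.X) : ℝ :=
  P.f₀ x + ∑ i, P.stageValue sm μ i x (W i x)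

theorem localPenalty_eq (sm : Smoothing) (μ pen : ℝ) (W : (i : Fin P.N) → P.X → P.V i) (x : P.X) :
    P.localPenalty sm μ pen W x = P.smoothPart sm μ W x + pen * posPartL1 (P.c₀ x) := rfl

theorem IsSmooth.contDiffAt_smoothPart {sm : Smoothing} (h : P.IsSmooth sm) (μ : ℝ) {x : P.X}
    {W : (i : Fin P.N) → P.X → P.V i} (hW : ∀ i, ContDiffAt ℝ 1 (W i) x)
    (hs : ∀ i j, 0 < sPart (W i x) j) : ContDiffAt ℝ 1 (P.smoothPart sm μ W) x := by
  refine h.f₀_C1.contDiffAt.add (ContDiffAt.sum fun i _ => ?_)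
  exact ContDiffAt.comp x (f := fun x => (x, W i x)) (h.contDiffAt_stageValue μ (hs i))
    (contDiffAt_id.prodMk (hW i))

theorem fderiv_smoothPart_apply {sm : Smoothing} (h : P.IsSmooth sm) {μ : ℝ} {x : P.X}
    {W : (i : Fin P.N) → P.X → P.V i} {g : Fin P.N → P.X}
    (hg : ∀ i, HasGradientAt (fun x' => P.stageValue sm μ i x' (W i x')) (g i) x) (p : P.X) :
    fderiv ℝ (P.smoothPart sm μ W) x p = inner ℝ (gradient P.f₀ x + ∑ i, g i) p := by
  have h0 := (h.f₀_C1.differentiable (by norm_num) x).hasGradientAt.hasFDerivAt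
  have h1 := h0.add (HasFDerivAt.fun_sum fun i (_ : i ∈ Finset.univ) => (hg i).hasFDerivAt)
  have h2 : fderiv ℝ (P.smoothPart sm μ W) x = _ := h1.fderiv
  rw [h2, inner_add_left, sum_inner]
  simp

/-- Differences of model values do not see the base values at `v`; only the returned gradients link
the model to `W`. -/
theorem model_sub_model_zero {sm : Smoothing} (h : P.IsSmooth sm) {μ pen : ℝ} {x : P.X}
    {W : (i : Fin P.N) → P.X → P.V i} {v : (i : Fin P.N) → P.V i} {g : Fin P.N → P.X}
    (hg : ∀ i, HasGradientAt (fun x' => P.stageValue sm μ i x' (W i x')) (g i) x)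
    (H : P.X →L[ℝ] P.X) (p : P.X) :
    P.model sm μ pen x v g H p - P.model sm μ pen x v g H 0 =
      linearizedChange pen (P.smoothPart sm μ W) P.c₀ x p + 1 / 2 * inner ℝ p (H p) := by
  unfold linearizedChange model
  rw [fderiv_smoothPart_apply h hg]
  simp only [map_zero, inner_zero_right, add_zero]
  ring

/-- Continuity keeps the graph of `W'` near `xb` inside the ball where zeros are unique. The germ of
the local penalty function is thus independent of the chosen solution maps. -/
theorem IsSolutionMap.eventuallyEq_of_graph {μ : ℝ} {i : Fin P.N} {xb : P.X} {vb : P.V i} {r₂ r : ℝ}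
    {W W' : P.X → P.V i} (hW' : P.IsSolutionMap μ i xb vb (Metric.ball xb r) W') (hr : 0 < r)
    (hr₂ : 0 < r₂)
    (hgraph : ∀ x v, P.InBall xb vb r₂ x v → (x, v) ∈ P.stationarySet μ i → v = W x) :
    W' =ᶠ[𝓝 xb] W := by
  have hc : ContinuousAt W' xb := hW'.continuousOn.continuousAt (Metric.ball_mem_nhds _ hr)
  have h1 : Tendsto (fun x => (x, W' x)) (𝓝 xb) (𝓝 (xb, vb)) := by
    have := continuousAt_id.prodMk hc
    rw [ContinuousAt, hW'.ref] at this
    exact this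
  filter_upwards [h1.eventually (eventually_inBall xb vb hr₂), Metric.ball_mem_nhds xb hr]
    with x hx hxr
  exact hgraph x _ hx (hW'.mem x hxr)

end TwoStageProblem

/-! ### Stationarity through one-sided directional derivatives. -/

theorem IsStationaryPoint.congr {n : ℕ} {φ ψ : Vec n → ℝ} {x : Vec n} (h : φ =ᶠ[𝓝 x] ψ)
    (hφ : IsStationaryPoint φ x) : IsStationaryPoint ψ x := by
  have key : subdifferential φ x = subdifferential ψ x := by
    ext g
    refine forall_congr' fun d => exists_congr fun l => and_congr_left fun _ =>
      tendsto_congr' ?_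
    have hc : Tendsto (fun t : ℝ => x + t • d) (𝓝[>] 0) (𝓝 x) := by
      have : Continuous fun t : ℝ => x + t • d := by fun_prop
      simpa using (this.tendsto 0).mono_left nhdsWithin_le_nhds
    filter_upwards [hc.eventually h] with t ht
    rw [ht, h.self_of_nhds]
  unfold IsStationaryPoint
  rw [← key]
  exact hφ

theorem IsStationaryPoint.of_directional_nonneg {n : ℕ} {φ : Vec n → ℝ} {x : Vec n}
    (h : ∀ d : Vec n, ∃ l : ℝ,
      Tendsto (fun t : ℝ => (φ (x + t • d) - φ x) / t) (𝓝[>] 0) (𝓝 l) ∧ 0 ≤ l) :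
    IsStationaryPoint φ x := by
  refine ⟨0, fun d => ?_, fun g _ => by simp, rfl⟩
  simpa using h d

/-! ### Runs of the algorithm and their limit points. -/

namespace Trajectory

variable {P : TwoStageProblem} {T : Trajectory P} {sm : Smoothing} {μ : ℝ} {a : TrustRegionParams}
  {sol : P.Solver}

theorem IsRun.isKKTPoint (hT : T.IsRun sm μ a sol) (hR : T.FullRecourse μ sol) (k : ℕ)
    (i : Fin P.N) : P.IsKKTPoint μ i (T.x k) (T.v k i) := by
  induction k with
  | zero => rw [hT.init_v]; exact hR.init_kkt i
  | succ k ih =>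
    rcases lt_or_ge (T.ratio sm μ a.pen k) a.η₁ with h | h
    · obtain ⟨h1, h2⟩ := hT.reject k h
      rw [h1, h2]
      exact ih
    · obtain ⟨h1, h2⟩ := hT.accept k h
      rw [h1, h2, hT.trial]
      exact hR.trial_kkt k i

theorem IsRun.modelAt_le_modelAt_zero (hT : T.IsRun sm μ a sol) (k : ℕ) :
    T.modelAt sm μ a.pen k (T.p k) ≤ T.modelAt sm μ a.pen k 0 :=
  hT.step_min k 0 (by simpa using (norm_nonneg _).trans (hT.step_mem k))

theorem IsRun.penalty_decrease (ha : a.Valid) (hT : T.IsRun sm μ a sol) {k : ℕ}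
    (h : a.η₁ ≤ T.ratio sm μ a.pen k) :
    a.η₁ * (T.modelAt sm μ a.pen k 0 - T.modelAt sm μ a.pen k (T.p k)) ≤
      P.penalty sm μ a.pen (T.x k) (T.v k) -
        P.penalty sm μ a.pen (T.x (k + 1)) (T.v (k + 1)) := by
  obtain ⟨h1, h2⟩ := hT.accept k h
  rw [h1, h2]
  rcases (hT.modelAt_le_modelAt_zero k).eq_or_lt with h3 | h3
  -- With zero predicted decrease the ratio is `0` by the division convention, so the step is not
  -- accepted.
  · unfold ratio at h
    rw [h3, sub_self, div_zero] at h
    exact absurd ha.η₁_pos (not_lt.2 h)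
  · exact (le_div_iff₀ (sub_pos.2 h3)).1 h

theorem IsRun.antitone_penalty (ha : a.Valid) (hT : T.IsRun sm μ a sol) :
    Antitone fun k => P.penalty sm μ a.pen (T.x k) (T.v k) := by
  refine antitone_nat_of_succ_le fun k => ?_
  rcases lt_or_ge (T.ratio sm μ a.pen k) a.η₁ with h | h
  · obtain ⟨h1, h2⟩ := hT.reject k h
    rw [h1, h2]
  · have h1 := hT.penalty_decrease ha h
    have h2 := mul_nonneg ha.η₁_pos.le (sub_nonneg.2 (hT.modelAt_le_modelAt_zero k))
    linarith

/-- A value below the one at the limit would bound all later values by monotonicity, contradicting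
continuity of the penalty at the cluster point. -/
theorem IsRun.penalty_le (ha : a.Valid) (hT : T.IsRun sm μ a sol) (hP : P.IsSmooth sm)
    {xinf : P.X} {vinf : (i : Fin P.N) → P.V i}
    (hlim : MapClusterPt (xinf, vinf) atTop (fun k => (T.x k, T.v k)))
    (hs : ∀ i j, 0 < TwoStageProblem.sPart (vinf i) j) (k : ℕ) :
    P.penalty sm μ a.pen xinf vinf ≤ P.penalty sm μ a.pen (T.x k) (T.v k) := by
  by_contra! hlt
  have h1 := hlim.frequently
    ((hP.continuousAt_penalty μ a.pen hs).eventually_const_lt hlt)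
  obtain ⟨j, hj, hkj⟩ := (h1.and_eventually (eventually_ge_atTop k)).exists
  exact absurd (hT.antitone_penalty ha hkj) (not_le.2 hj)

theorem IsRun.isKKTPoint_of_mapClusterPt (hμ : 0 < μ) (hT : T.IsRun sm μ a sol)
    (hR : T.FullRecourse μ sol) (hP : P.IsSmooth sm)
    {xinf : P.X} {vinf : (i : Fin P.N) → P.V i}
    (hlim : MapClusterPt (xinf, vinf) atTop (fun k => (T.x k, T.v k))) (i : Fin P.N) :
    P.IsKKTPoint μ i xinf (vinf i) := by
  have hc : Continuous fun q : P.X × ((i : Fin P.N) → P.V i) => (q.1, q.2 i) := by fun_prop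
  have hS : IsClosed {q : P.X × ((i : Fin P.N) → P.V i) | (q.1, q.2 i) ∈ P.stationarySet μ i} :=
    (TwoStageProblem.isClosed_stationarySet hP μ i).preimage hc
  have hs : IsClosed {q : P.X × ((i : Fin P.N) → P.V i) |
      ∀ j, 0 ≤ TwoStageProblem.sPart (q.2 i) j} := by
    simp only [ofPred_forall]
    exact isClosed_iInter fun j => isClosed_le continuous_const (by
      unfold TwoStageProblem.sPart; fun_prop)
  have key : (xinf, vinf) ∈ {q : P.X × ((i : Fin P.N) → P.V i) |
      (q.1, q.2 i) ∈ P.stationarySet μ i} ∩ {q : P.X × ((i : Fin P.N) → P.V i) |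
      ∀ j, 0 ≤ TwoStageProblem.sPart (q.2 i) j} := by
    refine (hS.inter hs).mem_of_mapClusterPt hlim (.of_forall fun k => ?_)
    exact ⟨(hT.isKKTPoint hR k i).1, fun j => ((hT.isKKTPoint hR k i).2 j).le⟩
  exact .of_nonneg hμ key.1 key.2

/-- The limit point is stationary for the penalty function along the solution maps on whose graphs
the warm-started solver stays. -/
theorem IsRun.isStationaryPoint_localPenalty (ha : a.Valid) (hT : T.IsRun sm μ a sol)
    (hR : T.FullRecourse μ sol) (hP : P.IsSmooth sm) {C : ℝ} (hC : ∀ k, ‖T.H k‖ ≤ C)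
    {xinf : P.X} {vinf : (i : Fin P.N) → P.V i}
    (hlim : MapClusterPt (xinf, vinf) atTop (fun k => (T.x k, T.v k)))
    (hs : ∀ i j, 0 < TwoStageProblem.sPart (vinf i) j)
    (hJ : ∀ i, P.JacobianNonsingular μ i xinf (vinf i))
    {r₁ r₂ r₃ : Fin P.N → ℝ} {W : (i : Fin P.N) → P.X → P.V i} (hr₁ : ∀ i, 0 < r₁ i)
    (hr₂ : ∀ i, 0 < r₂ i) (hr₃ : ∀ i, 0 < r₃ i)
    (hWC : ∀ i, ContDiffOn ℝ 1 (W i) (Metric.ball xinf (r₁ i)))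
    (hW : ∀ i, P.IsSolutionMap μ i xinf (vinf i) (Metric.ball xinf (r₁ i)) (W i))
    (hgraph : ∀ i x v, P.InBall xinf (vinf i) (r₂ i) x v → (x, v) ∈ P.stationarySet μ i →
      v = W i x)
    (hcons : ∀ i k, P.InBall xinf (vinf i) (r₃ i) (T.x k) (T.v k i) →
      ∀ p : P.X, ‖p‖ ≤ r₃ i →
        P.InBall xinf (vinf i) (r₂ i) (T.x k + p) (sol i (T.x k + p) (T.v k i))) :
    IsStationaryPoint (P.localPenalty sm μ a.pen W) xinf := by
  have hWx : ∀ i, ContDiffAt ℝ 1 (W i) xinf := fun i =>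
    (hWC i).contDiffAt (Metric.ball_mem_nhds _ (hr₁ i))
  have hsW : ∀ i j, 0 < TwoStageProblem.sPart (W i xinf) j := fun i => by
    rw [(hW i).ref]; exact hs i
  have hh := hP.contDiffAt_smoothPart μ hWx hsW
  have hc := hP.c₀_C1.contDiffAt (x := xinf)
  have hpen := ha.pen_pos.le
  by_contra hns
  obtain ⟨q, hq⟩ : ∃ q, TwoStageProblem.linearizedChange a.pen (P.smoothPart sm μ W) P.c₀
      xinf q < 0 := by
    by_contra! hall
    refine hns (.of_directional_nonneg fun d => ?_)
    obtain ⟨l, hl⟩ := TwoStageProblem.exists_tendsto_directional (pen := a.pen)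
      (hh.differentiableAt one_ne_zero) (hc.differentiableAt one_ne_zero) d
    refine ⟨l, hl, ?_⟩
    by_contra! hl0
    obtain ⟨q, hq⟩ := TwoStageProblem.exists_linearizedChange_neg hpen hh hc hl0 hl
    exact absurd (hall q) (not_le.2 hq)
  obtain ⟨κ, hκ, D₀, hD₀, hdecr⟩ :=
    TwoStageProblem.exists_sufficient_decrease hpen hh hc hq C
  have hη := sub_pos.2 ha.η₂_lt
  -- The linearization error and the quadratic term of the model may each use half of the slack `κ *
  -- (1 - η₂) * Δ` in the ratio test.
  have hε : 0 < κ * (1 - a.η₂) / 2 := by positivity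
  obtain ⟨δ₁, hδ₁, happrox⟩ :=
    TwoStageProblem.exists_abs_sub_linearizedChange_le hpen hh hc hε
  have hWlim : ∀ i, Tendsto (fun x => (x, W i x)) (𝓝 xinf) (𝓝 (xinf, vinf i)) := fun i => by
    have := continuousAt_id.prodMk (hWx i).continuousAt
    rw [ContinuousAt, (hW i).ref] at this
    exact this
  have hev : ∀ᶠ x in 𝓝 xinf, ∀ i, P.InBall xinf (vinf i) (r₃ i) x (W i x) ∧
      P.JacobianNonsingular μ i x (W i x) ∧ x ∈ Metric.ball xinf (r₁ i) :=
    eventually_all.2 fun i =>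
      ((hWlim i).eventually (TwoStageProblem.eventually_inBall _ _ (hr₃ i))).and
        (((hWlim i).eventually ((hJ i).eventually hP)).and (Metric.ball_mem_nhds _ (hr₁ i)))
  obtain ⟨δ₂, hδ₂, hnear⟩ := Metric.eventually_nhds_iff.1 (hev.and hdecr)
  simp only [dist_eq_norm] at hnear
  set δ := min δ₁ δ₂
  have hδ : 0 < δ := lt_min hδ₁ hδ₂
  obtain ⟨D, ⟨hD1, hD2, hD3, hD4⟩, hD⟩ : ∃ D, (D ≤ D₀ ∧ D < δ₁ ∧ (∀ i, D ≤ r₃ i) ∧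
      |C| * D ≤ κ * (1 - a.η₂)) ∧ 0 < D := by
    have h0 : Tendsto (fun D : ℝ => D) (𝓝[>] 0) (𝓝 0) := nhdsWithin_le_nhds
    have h1 : Tendsto (fun D : ℝ => |C| * D) (𝓝[>] 0) (𝓝 0) := by
      simpa using h0.const_mul |C|
    exact (((h0.eventually_le_const hD₀).and ((h0.eventually_lt_const hδ₁).and
      ((eventually_all.2 fun i => h0.eventually_le_const (hr₃ i)).and
        (h1.eventually_le_const (by positivity))))).and self_mem_nhdsWithin).exists
  -- At such iterates the penalty of the run agrees with the local penalty function along `W`.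
  set G : ℕ → Prop := fun k => ‖T.x k - xinf‖ < δ ∧ ∀ i, T.v k i = W i (T.x k) with hG
  have hgrad : ∀ k, G k → ∀ i,
      HasGradientAt (fun x' => P.stageValue sm μ i x' (W i x')) (T.g k i) (T.x k) := by
    rintro k ⟨hk, hv⟩ i
    obtain ⟨-, hJk, hball⟩ := (hnear (hk.trans_le (min_le_right _ _))).1 i
    obtain ⟨r, hr, hsub⟩ := Metric.isOpen_iff.1 Metric.isOpen_ball _ hball
    -- Restricted to a small ball around the iterate, `W i` is a solution map with the iterate as
    -- reference point, so the returned gradient is the one along `W i`.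
    refine hT.grad k i ⟨(hT.isKKTPoint hR k i).1, by rw [hv i]; exact hJk⟩ r hr (W i)
      ⟨(hW i).continuousOn.mono hsub, fun x hx => (hW i).mem x (hsub hx), (hv i).symm⟩
  have hmodel : ∀ k, G k → ∀ p, T.modelAt sm μ a.pen k p - T.modelAt sm μ a.pen k 0 =
      TwoStageProblem.linearizedChange a.pen (P.smoothPart sm μ W) P.c₀ (T.x k) p +
        1 / 2 * inner ℝ p (T.H k p) := fun k hk p =>
    TwoStageProblem.model_sub_model_zero hP (hgrad k hk) _ p
  have hΔ : ∀ k, 0 < T.Δ k := fun k =>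
    (norm_pos_iff.2 (hT.step_ne k)).trans_le (hT.step_mem k)
  have hpred : ∀ k, G k → κ * min (T.Δ k) D₀ ≤
      T.modelAt sm μ a.pen k 0 - T.modelAt sm μ a.pen k (T.p k) := by
    intro k hk
    obtain ⟨p, hp, hp'⟩ := (hnear (hk.1.trans_le (min_le_right _ _))).2 (T.H k) (hC k) (T.Δ k)
      (hΔ k)
    rw [← hmodel k hk] at hp'
    linarith [hT.step_min k p hp]
  -- For short steps, consistency keeps the solver output in the ball where zeros of the optimality
  -- map lie on the graph of `W i`.
  have htrial : ∀ k, G k → T.Δ k ≤ D → ∀ i, T.vt k i = W i (T.x k + T.p k) := by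
    intro k hk hkD i
    have h1 := ((hnear (hk.1.trans_le (min_le_right _ _))).1 i).1
    rw [← hk.2 i] at h1
    have h2 := hcons i k h1 (T.p k) ((hT.step_mem k).trans (hkD.trans (hD3 i)))
    rw [hT.trial]
    exact hgraph i _ _ h2 (hR.trial_kkt k i).1
  refine ha.not_sufficient_decrease (κ := a.η₁ * κ) (D := D) (δ := δ) (x₀ := xinf) (G := G)
    (φinf := P.penalty sm μ a.pen xinf vinf) (mul_pos ha.η₁_pos hκ) hD hδ hT.init_Δ hT.step_mem
    hT.radius_increase hT.radius_keep hT.radius_decrease (fun k hk => (hT.accept k hk).1)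
    (fun k hk => (hT.reject k hk).1) (hT.antitone_penalty ha) (hT.penalty_le ha hP hlim hs)
    ?_ ?_ ?_ ?_ ?_
  · intro k hk hacc
    refine le_trans ?_ (hT.penalty_decrease ha hacc)
    have h1 := hpred k hk
    have h2 : κ * min (T.Δ k) D ≤ κ * min (T.Δ k) D₀ := by gcongr
    rw [mul_assoc]
    exact mul_le_mul_of_nonneg_left (h2.trans h1) ha.η₁_pos.le
  · intro k hk hkD
    have h1 := hpred k hk
    rw [min_eq_left (hkD.trans hD1)] at h1
    have hpos : 0 < T.modelAt sm μ a.pen k 0 - T.modelAt sm μ a.pen k (T.p k) :=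
      (mul_pos hκ (hΔ k)).trans_le h1
    have hpΔ := hT.step_mem k
    have h2 := (abs_le.1 (happrox (T.x k) (T.p k) (hk.1.trans_le (min_le_left _ _))
      ((hpΔ.trans hkD).trans_lt hD2))).2
    have h3 := hmodel k hk (T.p k)
    have e1 : P.penalty sm μ a.pen (T.x k) (T.v k) = P.smoothPart sm μ W (T.x k) +
        a.pen * TwoStageProblem.posPartL1 (P.c₀ (T.x k)) := by
      rw [← TwoStageProblem.localPenalty_eq, funext hk.2]
      rfl
    have e2 : P.penalty sm μ a.pen (T.x k + T.p k) (T.vt k) =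
        P.smoothPart sm μ W (T.x k + T.p k) +
        a.pen * TwoStageProblem.posPartL1 (P.c₀ (T.x k + T.p k)) := by
      rw [← TwoStageProblem.localPenalty_eq, funext (htrial k hk hkD)]
      rfl
    have h4 : -(|C| * D * T.Δ k) ≤ inner ℝ (T.p k) (T.H k (T.p k)) := by
      have b1 := (abs_le.1 (abs_real_inner_le_norm (T.p k) (T.H k (T.p k)))).1
      have b2 := (T.H k).le_of_opNorm_le ((hC k).trans (le_abs_self C)) (T.p k)
      have b3 : ‖T.p k‖ * ‖T.H k (T.p k)‖ ≤ T.Δ k * (|C| * D) := by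
        have := hpΔ.trans hkD
        have := (hΔ k).le
        calc _ ≤ T.Δ k * (|C| * ‖T.p k‖) := by gcongr
          _ ≤ _ := by gcongr
      linarith
    have h5 : κ * (1 - a.η₂) / 2 * ‖T.p k‖ ≤ κ * (1 - a.η₂) / 2 * T.Δ k := by gcongr
    have h6 : |C| * D * T.Δ k ≤ κ * (1 - a.η₂) * T.Δ k := by
      have := (hΔ k).le
      gcongr
    have h7 := mul_le_mul_of_nonneg_left h1 hη.le
    -- The actual decrease falls short of the predicted one by at most `κ * (1 - η₂) * Δ`, hence by
    -- at most `1 - η₂` times the predicted decrease.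
    unfold ratio
    rw [le_div_iff₀ hpos, e1, e2]
    linarith
  · intro k hk hacc hkD hlt
    refine ⟨hlt, fun i => ?_⟩
    obtain ⟨h1, h2⟩ := hT.accept k hacc
    rw [h1, h2]
    exact htrial k hk hkD i
  · intro k hk hrej
    obtain ⟨h1, h2⟩ := hT.reject k hrej
    simp only [hG, h1, h2]
    exact hk
  · intro ε hε'
    have c1 : ∀ᶠ q in 𝓝 (xinf, vinf), ∀ i, P.InBall xinf (vinf i) (r₂ i) q.1 (q.2 i) :=
      eventually_all.2 fun i => by
        have hc : Continuous fun q : P.X × ((i : Fin P.N) → P.V i) => (q.1, q.2 i) := by fun_prop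
        exact (hc.tendsto (xinf, vinf)).eventually
          (TwoStageProblem.eventually_inBall _ _ (hr₂ i))
    have c2 : ∀ᶠ q in 𝓝 (xinf, vinf), ‖q.1 - xinf‖ < min ε δ := by
      have hc : ContinuousAt (fun q : P.X × ((i : Fin P.N) → P.V i) => ‖q.1 - xinf‖)
        (xinf, vinf) := by fun_prop
      exact hc.eventually_lt continuousAt_const (by simpa using ⟨hε', hδ⟩)
    have c3 := (hP.continuousAt_penalty μ a.pen (x := xinf) hs).eventually_lt_const
      (lt_add_of_pos_right _ hε')
    obtain ⟨k, k1, k2, k3⟩ := (hlim.frequently (c1.and (c2.and c3))).exists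
    exact ⟨k, ⟨k2.trans_le (min_le_right _ _), fun i =>
      hgraph i _ _ (k1 i) (hT.isKKTPoint hR k i).1⟩, k2.trans_le (min_le_left _ _), k3⟩

end Trajectory

end

theorem mainTheorem1 (P : TwoStageProblem) (sm : Smoothing) (μ : ℝ) (hμ : 0 < μ)
    (a : TrustRegionParams) (ha : a.Valid) (sol : P.Solver) (T : Trajectory P)
    (hsmooth : P.IsSmooth sm)
    (hrun : T.IsRun sm μ a sol)
    (hrecourse : T.FullRecourse μ sol)
    (hconsistent : T.ConsistentOutput μ sol)
    (hH : ∃ C : ℝ, ∀ k, ‖T.H k‖ ≤ C)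
    (xinf : P.X) (vinf : (i : Fin P.N) → P.V i)
    (hlim : MapClusterPt (xinf, vinf) atTop (fun k => (T.x k, T.v k)))
    (hnondeg : ∀ i, P.JacobianNonsingular μ i xinf (vinf i)) :
    (∃ r > 0, ∃ W : (i : Fin P.N) → P.X → P.V i, ∀ i,
      ContDiffOn ℝ 1 (W i) (Metric.ball xinf r) ∧
      P.IsSolutionMap μ i xinf (vinf i) (Metric.ball xinf r) (W i) ∧
      ∀ x ∈ Metric.ball xinf r, P.IsKKTPoint μ i x (W i x)) ∧
    ∀ r > 0, ∀ W : (i : Fin P.N) → P.X → P.V i,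
      (∀ i, P.IsSolutionMap μ i xinf (vinf i) (Metric.ball xinf r) (W i)) →
      IsStationaryPoint (P.localPenalty sm μ a.pen W) xinf := by
  obtain ⟨C, hC⟩ := hH
  have hkkt := hrun.isKKTPoint_of_mapClusterPt hμ hrecourse hsmooth hlim
  have hN : ∀ i, P.IsNondegenerate μ i xinf (vinf i) := fun i => ⟨(hkkt i).1, hnondeg i⟩
  choose r₂ hgr r₃ hr₃ hcons using fun i => hconsistent i xinf (vinf i) (hN i)
    (TwoStageProblem.exists_isGraphRadius hsmooth (hN i))
  choose hr₂ r₁ hr₁₂ W hWC hW hgraph using hgr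
  have hr₁ : ∀ i, 0 < r₁ i := fun i => (hr₂ i).trans_le (hr₁₂ i)
  refine ⟨?_, fun r hr W' hW' => ?_⟩
  -- The balls are shrunk to a common radius on which the slacks remain positive by continuity.
  · have hev : ∀ᶠ x in 𝓝 xinf, ∀ i, x ∈ Metric.ball xinf (r₁ i) ∧
        ∀ j, 0 < TwoStageProblem.sPart (W i x) j := by
      refine eventually_all.2 fun i =>
        Eventually.and (Metric.ball_mem_nhds xinf (hr₁ i)) (eventually_all.2 fun j => ?_)
      have hWx := (hW i).continuousOn.continuousAt (Metric.ball_mem_nhds xinf (hr₁ i))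
      have hc : ContinuousAt (fun x => TwoStageProblem.sPart (W i x) j) xinf := by
        unfold TwoStageProblem.sPart
        fun_prop
      refine continuousAt_const.eventually_lt hc ?_
      simp only [(hW i).ref]
      exact (hkkt i).2 j
    obtain ⟨r, hr, h⟩ := Metric.eventually_nhds_iff.1 hev
    refine ⟨r, hr, W, fun i => ?_⟩
    have hsub : Metric.ball xinf r ⊆ Metric.ball xinf (r₁ i) := fun x hx => (h hx i).1
    exact ⟨(hWC i).mono hsub, ⟨(hW i).continuousOn.mono hsub,
      fun x hx => (hW i).mem x (hsub hx), (hW i).ref⟩,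
      fun x hx => ⟨(hW i).mem x (hsub hx), (h hx i).2⟩⟩
  · have heq : ∀ᶠ x in 𝓝 xinf, ∀ i, W' i x = W i x := eventually_all.2 fun i =>
      (hW' i).eventuallyEq_of_graph hr (hr₂ i) (hgraph i)
    refine IsStationaryPoint.congr ?_ (hrun.isStationaryPoint_localPenalty ha hrecourse hsmooth hC
      hlim (fun i => (hkkt i).2) hnondeg hr₁ hr₂ hr₃ hWC hW hgraph hcons)
    filter_upwards [heq] with x hx
    unfold TwoStageProblem.localPenalty
    rw [funext hx]
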